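/- For a (not necessarily unital) $C^*$-algebra $A$, let $\Lambda(A)\in[0,\infty]$ denote the smallest constant $C$ for which there is a net of finite rank linear maps $\phi_\alpha\colon A\to A$ with $\|\phi_\alpha\|_{cb}\le C$ for all $\alpha$ and $\lim_\alpha\|\phi_\alpha(x)-x\|=0$ for all $x\in A$; if there is no such net for any finite $C$, then $\Lambda(A)=\infty$. (Here $\|\phi\|_{cb}=\sup_n\|\mathrm{id}_n\otimes\phi\colon \mathbb M_n(A)\to\mathbb M_n(A)\|$.) Let $B$ be a $C^*$-algebra and let $H$ be a right Hilbert $B$-module which is full, i.e. such that the set of inner products $\{\langle h_1,h_2\rangle_B\colon h_1,h_2\in H\}$ generates $B$ as a $C^*$-algebra. Let $\mathcal L(H)$ be the $C^*$-algebra of adjointable operators on $H$, and let $\mathcal K(H)$ be the closed ideal of $\mathcal L(H)$ generated by the operators $\theta_{x,y}(h)=x\langle y,h\rangle_B$, $x,y\in H$. Then $$\Lambda(\mathcal K(H))\le\Lambda(B).$$ -/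

import Mathlib

universe u v

noncomputable section

open scoped ENNReal NNReal InnerProductSpace

set_option linter.unusedSectionVars false

/-! ### The Haagerup invariant of a C⋆-algebra -/

/-- The completely bounded norm of a linear map `φ : A → B` between C⋆-algebras, i.e. the supremum
over `n` of the norms of the maps `φ ⊗ id : M_n(A) → M_n(B)` that apply `φ` to each entry, where
`M_n` carries its C⋆-norm; the value is `∞` if `φ` is not completely bounded. -/
def cbNorm {A B : Type*}
    [NonUnitalCStarAlgebra A] [PartialOrder A] [StarOrderedRing A]
    [NonUnitalCStarAlgebra B] [PartialOrder B] [StarOrderedRing B] (φ : A →ₗ[ℂ] B) : ℝ≥0∞ :=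
  ⨆ (n : ℕ) (M : CStarMatrix (Fin n) (Fin n) A) (_ : ‖M‖ ≤ 1), ‖M.map φ‖ₑ

/-- There is a net of finite rank maps `φ i : A → A` with completely bounded norms at most `C` that
converges to the identity in the point-norm topology. The order on `A`, which Mathlib uses to set up
the C⋆-norm of `M_n(A)`, is the usual order of a C⋆-algebra, given by its positive elements. -/
def HasFiniteRankNet (A : Type u) [NonUnitalCStarAlgebra A] (C : ℝ≥0) : Prop :=
  letI : PartialOrder A := CStarAlgebra.spectralOrder A
  haveI : StarOrderedRing A := CStarAlgebra.spectralOrderedRing A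
  ∃ (ι : Type u) (_ : Preorder ι) (_ : IsDirectedOrder ι) (_ : Nonempty ι) (φ : ι → A →ₗ[ℂ] A),
    (∀ i, FiniteDimensional ℂ (LinearMap.range (φ i))) ∧
    (∀ i, cbNorm (φ i) ≤ C) ∧
    ∀ x, Filter.Tendsto (fun i => ‖φ i x - x‖) Filter.atTop (nhds 0)

/-- The Haagerup invariant `Λ(A)`: the infimum (which is attained if it is finite) of the constants
`C` for which there is a net as in `HasFiniteRankNet A C`, and `∞` if there is no such `C`. -/
def haagerupInvariant (A : Type u) [NonUnitalCStarAlgebra A] : ℝ≥0∞ :=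
  ⨅ (C : ℝ≥0) (_ : HasFiniteRankNet A C), (C : ℝ≥0∞)

/-! ### Right Hilbert modules

Mathlib's `CStarModule A H` is written with the action of `A` on the left: `⟪x, a • y⟫ = a * ⟪x, y⟫`.
For `A = Bᵐᵒᵖ` this is exactly a right pre-Hilbert `B`-module, with `h · b = MulOpposite.op b • h`
and with the `B`-valued inner product `rightInner B`; a right Hilbert `B`-module is a complete one.
-/

namespace RightHilbert

open MulOpposite

variable (B : Type u) [NonUnitalCStarAlgebra B] [PartialOrder B] [StarOrderedRing B]
variable {H : Type v} [NormedAddCommGroup H] [NormedSpace ℂ H] [SMul Bᵐᵒᵖ H] [CStarModule Bᵐᵒᵖ H]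

/-- The `B`-valued inner product of a right Hilbert `B`-module, conjugate linear in the first
variable and linear in the second one. -/
def rightInner (x y : H) : B := unop ⟪x, y⟫_(Bᵐᵒᵖ)

lemma rightInner_smul (x y : H) (b : B) :
    rightInner B x (op b • y) = rightInner B x y * b := by
  simp [rightInner]

lemma star_rightInner (x y : H) : star (rightInner B x y) = rightInner B y x := by
  rw [rightInner, ← unop_star, CStarModule.star_inner, rightInner]

lemma ext_inner {x y : H} (h : ∀ z : H, ⟪z, x⟫_(Bᵐᵒᵖ) = ⟪z, y⟫_(Bᵐᵒᵖ)) : x = y := by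
  rw [← sub_eq_zero, ← CStarModule.inner_self (A := Bᵐᵒᵖ), CStarModule.inner_sub_right, h, sub_self]

/-- The module laws follow from the laws of the inner product. -/
lemma smul_smul_op (h : H) (b c : B) : op c • op b • h = op (b * c) • h :=
  ext_inner B fun z => by simp [mul_assoc]

/-- `H` is full: the inner products `⟨h₁, h₂⟩` generate `B` as a C⋆-algebra. -/
def IsFull (H : Type v) [NormedAddCommGroup H] [NormedSpace ℂ H] [SMul Bᵐᵒᵖ H]
    [CStarModule Bᵐᵒᵖ H] : Prop :=
  (NonUnitalStarAlgebra.adjoin ℂ {b : B | ∃ h₁ h₂ : H, rightInner B h₁ h₂ = b}).topologicalClosure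
    = ⊤

/-- `S` is an adjoint of `T`. -/
def IsAdjoint (T S : H →L[ℂ] H) : Prop := ∀ x y : H, rightInner B (T x) y = rightInner B x (S y)

variable {B}

lemma isAdjoint_iff {T S : H →L[ℂ] H} :
    IsAdjoint B T S ↔ ∀ x y : H, ⟪T x, y⟫_(Bᵐᵒᵖ) = ⟪x, S y⟫_(Bᵐᵒᵖ) := by
  simp [IsAdjoint, rightInner]

namespace IsAdjoint

lemma symm {T S : H →L[ℂ] H} (h : IsAdjoint B T S) : IsAdjoint B S T := fun x y => by
  rw [← star_rightInner, ← h, star_rightInner]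

lemma unique {T S S' : H →L[ℂ] H} (h : IsAdjoint B T S) (h' : IsAdjoint B T S') : S = S' := by
  ext y
  exact ext_inner B fun z => by rw [← isAdjoint_iff.1 h, ← isAdjoint_iff.1 h']

/-- Adjointable maps are `B`-linear. -/
lemma map_op_smul {T S : H →L[ℂ] H} (h : IsAdjoint B T S) (b : B) (x : H) :
    T (op b • x) = op b • T x :=
  ext_inner B fun z => by
    rw [← isAdjoint_iff.1 h.symm, CStarModule.inner_op_smul_right, CStarModule.inner_op_smul_right,
      isAdjoint_iff.1 h.symm]

lemma add {T S T' S' : H →L[ℂ] H} (h : IsAdjoint B T S) (h' : IsAdjoint B T' S') :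
    IsAdjoint B (T + T') (S + S') := isAdjoint_iff.2 fun x y => by
  simp [isAdjoint_iff.1 h, isAdjoint_iff.1 h']

lemma smul {T S : H →L[ℂ] H} (h : IsAdjoint B T S) (c : ℂ) :
    IsAdjoint B (c • T) (star c • S) := isAdjoint_iff.2 fun x y => by
  simp [isAdjoint_iff.1 h]

lemma mul {T S T' S' : H →L[ℂ] H} (h : IsAdjoint B T S) (h' : IsAdjoint B T' S') :
    IsAdjoint B (T * T') (S' * S) := isAdjoint_iff.2 fun x y => by
  simp [isAdjoint_iff.1 h, isAdjoint_iff.1 h']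

lemma one : IsAdjoint B (1 : H →L[ℂ] H) 1 := fun _ _ => rfl

lemma sq_norm_le {T S : H →L[ℂ] H} (h : IsAdjoint B T S) : ‖T‖ * ‖T‖ ≤ ‖S * T‖ := by
  have : ‖T‖ ≤ √‖S * T‖ := by
    refine T.opNorm_le_bound (by positivity) fun x => ?_
    refine (abs_le_of_sq_le_sq' ?_ (by positivity)).2
    rw [CStarModule.norm_sq_eq Bᵐᵒᵖ, isAdjoint_iff.1 h, mul_pow, Real.sq_sqrt (norm_nonneg _)]
    calc ‖⟪x, S (T x)⟫_(Bᵐᵒᵖ)‖ ≤ ‖x‖ * ‖(S * T) x‖ := CStarModule.norm_inner_le H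
      _ ≤ ‖x‖ * (‖S * T‖ * ‖x‖) := by gcongr; exact (S * T).le_opNorm x
      _ = ‖S * T‖ * ‖x‖ ^ 2 := by ring
  calc ‖T‖ * ‖T‖ ≤ √‖S * T‖ * √‖S * T‖ := by gcongr
    _ = ‖S * T‖ := Real.mul_self_sqrt (norm_nonneg _)

lemma norm_le {T S : H →L[ℂ] H} (h : IsAdjoint B T S) : ‖T‖ ≤ ‖S‖ := by
  rcases (norm_nonneg T).eq_or_lt with h0 | h0
  · rw [← h0]; exact norm_nonneg _
  · exact le_of_mul_le_mul_right (h.sq_norm_le.trans (norm_mul_le S T)) h0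

end IsAdjoint

variable (B H)

/-- The algebra `L(H)` of adjointable operators on `H`, as a subalgebra of the bounded operators
(boundedness and `B`-linearity are automatic for maps that have an adjoint). -/
def adjointable : Subalgebra ℂ (H →L[ℂ] H) where
  carrier := {T | ∃ S, IsAdjoint B T S}
  mul_mem' := fun ⟨_, h⟩ ⟨_, h'⟩ => ⟨_, h.mul h'⟩
  add_mem' := fun ⟨_, h⟩ ⟨_, h'⟩ => ⟨_, h.add h'⟩
  algebraMap_mem' c := by
    rw [Algebra.algebraMap_eq_smul_one]
    exact ⟨_, IsAdjoint.one.smul c⟩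

variable {B H}

instance : StarRing (adjointable B H) where
  star T := ⟨T.2.choose, T.1, T.2.choose_spec.symm⟩
  star_involutive T := Subtype.ext <|
    (IsAdjoint.unique (Exists.choose_spec (p := fun S => IsAdjoint B T.2.choose S)
      ⟨T.1, T.2.choose_spec.symm⟩) T.2.choose_spec.symm)
  star_mul T T' := Subtype.ext <|
    (T * T').2.choose_spec.unique (T.2.choose_spec.mul T'.2.choose_spec)
  star_add T T' := Subtype.ext <|
    (T + T').2.choose_spec.unique (T.2.choose_spec.add T'.2.choose_spec)

/-- The involution of `L(H)` is the adjoint. -/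
lemma isAdjoint_star (T : adjointable B H) : IsAdjoint B T.1 (star T).1 := T.2.choose_spec

lemma coe_star_eq {T : adjointable B H} {S : H →L[ℂ] H} (h : IsAdjoint B T.1 S) :
    (star T).1 = S := (isAdjoint_star T).unique h

instance : StarModule ℂ (adjointable B H) where
  star_smul c T := Subtype.ext <| coe_star_eq ((isAdjoint_star T).smul c)

lemma isClosed_adjointable [CompleteSpace H] :
    IsClosed (adjointable B H : Set (H →L[ℂ] H)) := by
  refine IsSeqClosed.isClosed fun T T₀ hT hlim => ?_
  choose S hS using hT
  have hc : CauchySeq S := by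
    refine Metric.cauchySeq_iff.2 fun ε hε => ?_
    obtain ⟨N, hN⟩ := Metric.cauchySeq_iff.1 hlim.cauchySeq ε hε
    refine ⟨N, fun m hm n hn => lt_of_le_of_lt ?_ (hN m hm n hn)⟩
    rw [dist_eq_norm, dist_eq_norm]
    refine IsAdjoint.norm_le (B := B) (IsAdjoint.symm ?_)
    simpa [sub_eq_add_neg] using (hS m).add ((hS n).smul (-1))
  obtain ⟨S₀, hS₀⟩ := cauchySeq_tendsto_of_complete hc
  refine ⟨S₀, isAdjoint_iff.2 fun x y => ?_⟩
  have h1 : Filter.Tendsto (fun n => ⟪T n x, y⟫_(Bᵐᵒᵖ)) Filter.atTop (nhds ⟪T₀ x, y⟫_(Bᵐᵒᵖ)) :=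
    (CStarModule.continuous_inner.comp (Continuous.prodMk_left y)).continuousAt.tendsto.comp
      (((ContinuousLinearMap.apply ℂ H x).continuous.tendsto T₀).comp hlim)
  have h2 : Filter.Tendsto (fun n => ⟪x, S n y⟫_(Bᵐᵒᵖ)) Filter.atTop (nhds ⟪x, S₀ y⟫_(Bᵐᵒᵖ)) :=
    (CStarModule.continuous_inner.comp (Continuous.prodMk_right x)).continuousAt.tendsto.comp
      (((ContinuousLinearMap.apply ℂ H y).continuous.tendsto S₀).comp hS₀)
  refine tendsto_nhds_unique h1 (h2.congr fun n => ?_)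
  exact (isAdjoint_iff.1 (hS n) x y).symm

/-- `L(H)` is a C⋆-algebra for the operator norm and the adjoint. -/
instance [CompleteSpace H] : CStarAlgebra (adjointable B H) where
  toCompleteSpace := isClosed_adjointable.completeSpace_coe
  norm_mul_self_le T := (isAdjoint_star T).sq_norm_le

variable (B) in
/-- The operator `θ_{x,y}(h) = x · ⟨y, h⟩` as a bounded operator on `H`. -/
def thetaCLM (x y : H) : H →L[ℂ] H :=
  LinearMap.mkContinuous
    { toFun := fun h => op (rightInner B y h) • x
      map_add' := fun h k => ext_inner B fun z => by simp [rightInner, add_mul]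
      map_smul' := fun c h => ext_inner B fun z => by simp [rightInner, smul_mul_assoc] } (‖x‖ * ‖y‖) (by
    intro h
    refine (abs_le_of_sq_le_sq' ?_ (by positivity)).2
    rw [CStarModule.norm_sq_eq Bᵐᵒᵖ]
    simp only [LinearMap.coe_mk, AddHom.coe_mk, rightInner, op_unop,
      CStarModule.inner_op_smul_right, CStarModule.inner_op_smul_left, CStarModule.star_inner]
    calc ‖⟪y, h⟫_(Bᵐᵒᵖ) * (⟪x, x⟫_(Bᵐᵒᵖ) * ⟪h, y⟫_(Bᵐᵒᵖ))‖
        ≤ ‖⟪y, h⟫_(Bᵐᵒᵖ)‖ * (‖⟪x, x⟫_(Bᵐᵒᵖ)‖ * ‖⟪h, y⟫_(Bᵐᵒᵖ)‖) :=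
          (norm_mul_le _ _).trans (by gcongr; exact norm_mul_le _ _)
      _ ≤ (‖y‖ * ‖h‖) * (‖x‖ ^ 2 * (‖h‖ * ‖y‖)) := by
          rw [← CStarModule.norm_sq_eq Bᵐᵒᵖ]
          gcongr <;> exact CStarModule.norm_inner_le H
      _ = (‖x‖ * ‖y‖ * ‖h‖) ^ 2 := by ring)

lemma thetaCLM_apply (x y h : H) : thetaCLM B x y h = op (rightInner B y h) • x := rfl

lemma isAdjoint_thetaCLM (x y : H) : IsAdjoint B (thetaCLM B x y) (thetaCLM B y x) :=
  isAdjoint_iff.2 fun h k => by simp [thetaCLM_apply, rightInner]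

variable (B) in
/-- The operator `θ_{x,y}(h) = x · ⟨y, h⟩` as an element of `L(H)`. -/
def theta (x y : H) : adjointable B H :=
  ⟨thetaCLM B x y, thetaCLM B y x, isAdjoint_thetaCLM x y⟩

lemma star_theta (x y : H) : star (theta B x y) = theta B y x :=
  Subtype.ext <| coe_star_eq (isAdjoint_thetaCLM x y)

lemma mul_theta (T : adjointable B H) (x y : H) : T * theta B x y = theta B (T.1 x) y :=
  Subtype.ext <| ContinuousLinearMap.ext fun h => (isAdjoint_star T).map_op_smul _ x

lemma theta_mul (T : adjointable B H) (x y : H) :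
    theta B x y * T = theta B x ((star T).1 y) :=
  Subtype.ext <| ContinuousLinearMap.ext fun h => by
    change op (rightInner B y (T.1 h)) • x = op (rightInner B ((star T).1 y) h) • x
    rw [(isAdjoint_star T).symm y h]

variable (B H)

/-- The linear span of the operators `θ_{x,y}` in `L(H)`. -/
def thetaSpan : Submodule ℂ (adjointable B H) :=
  Submodule.span ℂ {T | ∃ x y : H, theta B x y = T}

variable {B H}

lemma mul_mem_thetaSpan (T : adjointable B H) {S : adjointable B H} (hS : S ∈ thetaSpan B H) :
    T * S ∈ thetaSpan B H := by
  induction hS using Submodule.span_induction with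
  | mem S h =>
    obtain ⟨x, y, rfl⟩ := h
    exact Submodule.subset_span ⟨_, _, (mul_theta T x y).symm⟩
  | zero => simp
  | add S S' _ _ h h' => rw [mul_add]; exact add_mem h h'
  | smul c S _ h => rw [mul_smul_comm]; exact Submodule.smul_mem _ c h

lemma star_mem_thetaSpan {S : adjointable B H} (hS : S ∈ thetaSpan B H) :
    star S ∈ thetaSpan B H := by
  induction hS using Submodule.span_induction with
  | mem S h =>
    obtain ⟨x, y, rfl⟩ := h
    exact Submodule.subset_span ⟨_, _, (star_theta x y).symm⟩
  | zero => simp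
  | add S S' _ _ h h' => rw [star_add]; exact add_mem h h'
  | smul c S _ h => rw [star_smul]; exact Submodule.smul_mem _ _ h

lemma mem_thetaSpan_mul (T : adjointable B H) {S : adjointable B H} (hS : S ∈ thetaSpan B H) :
    S * T ∈ thetaSpan B H := by
  have := star_mem_thetaSpan (mul_mem_thetaSpan (star T) (star_mem_thetaSpan hS))
  simpa using this

variable (B H)

/-- The C⋆-algebra `K(H)` of compact operators on `H`: the closed linear span in `L(H)` of the
operators `θ_{x,y}`. It is the closed ideal of `L(H)` generated by them, see
`isLeast_compactOperators`. -/
def compactOperators [CompleteSpace H] : NonUnitalStarSubalgebra ℂ (adjointable B H) :=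
  NonUnitalStarSubalgebra.topologicalClosure
    { thetaSpan B H with
      mul_mem' := fun {S _} _ h' => mul_mem_thetaSpan S h'
      star_mem' := star_mem_thetaSpan }

lemma coe_compactOperators [CompleteSpace H] :
    (compactOperators B H : Set (adjointable B H)) = closure (thetaSpan B H) := rfl

instance isClosed_compactOperators [CompleteSpace H] :
    IsClosed (compactOperators B H : Set (adjointable B H)) := isClosed_closure

lemma isLeast_compactOperators [CompleteSpace H] :
    IsLeast {K : Set (adjointable B H) | IsClosed K ∧ (∃ I : TwoSidedIdeal (adjointable B H),
      (I : Set (adjointable B H)) = K) ∧ ∀ x y : H, theta B x y ∈ K} (compactOperators B H) := by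
  refine ⟨⟨isClosed_compactOperators B H, ?_, fun x y => ?_⟩, ?_⟩
  · refine ⟨TwoSidedIdeal.mk' (compactOperators B H : Set (adjointable B H)) (zero_mem _)
      (add_mem · ·) (neg_mem ·) (fun {x y} h => ?_) (fun {x y} h => ?_),
      TwoSidedIdeal.coe_mk' ..⟩
    · exact map_mem_closure (f := fun S => x * S) (by fun_prop) h fun _ hS => mul_mem_thetaSpan x hS
    · exact map_mem_closure (f := fun S => S * y) (by fun_prop) h fun S hS => mem_thetaSpan_mul y hS
  · exact subset_closure (Submodule.subset_span ⟨x, y, rfl⟩)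
  · rintro _ ⟨hc, ⟨I, rfl⟩, hI⟩
    refine closure_minimal (fun S hS => ?_) hc
    induction hS using Submodule.span_induction with
    | mem S h => obtain ⟨x, y, rfl⟩ := h; exact hI x y
    | zero => exact zero_mem I
    | add S S' _ _ h h' => exact add_mem h h'
    | smul c S _ hS =>
      have := TwoSidedIdeal.mul_mem_left I (c • 1) S hS
      simpa using this

end RightHilbert

end

/-!
# `Λ(K(H)) ≤ Λ(B)` for a Hilbert `B`-module `H`

Vectors `x 1, …, x m` of `H` give the operator `X : Bᵐ → H`, `X v = ∑ i, x i · v i`, with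
`X X* = ∑ i, θ_{x i, x i}` (`frameOperator`). If this sum has norm at most `1`, then `X` is a
contraction, so that `T ↦ X* T X` and `b ↦ X b X*` are complete contractions between `K(H)` and
`M_m(B)`. Applying a finite rank map `φ : B → B` to the entries in between gives a finite rank map
`compressed x φ : K(H) → K(H)` with `‖compressed x φ‖_cb ≤ ‖φ‖_cb` (`cbNorm_compressed_le`), and for
`φ = id` it is `T ↦ (X X*) T (X X*)` (`coe_compressed_id`).

The operators `X X*` contain an approximate unit of `K(H)`
(`exists_frameOperator_mul_mul_approx`): for `a = ∑ i, θ_{y i, y i}` and small `δ > 0`, the vectors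
`x i = (a + δ)^(-1/2) (y i)` have `X X* = a (a + δ)⁻¹`, which is a contraction and nearly fixes each
`y i`. So the maps `compressed x φ`, with `φ` running through a net for `B`, contain a net for
`K(H)` with the same bound.

The norms of `M_n(K(H))` and `M_n(B)` are computed as operator norms on the Hilbert modules `Hⁿ` and
`Bⁿ` (`norm_matrixHom`), because an injective star homomorphism of C⋆-algebras is isometric. In the
convention of `CStarModule`, the right Hilbert module `B` is the type `Bᵐᵒᵖ`.
-/

noncomputable section

open scoped ENNReal NNReal InnerProductSpace WithCStarModule

set_option linter.unusedSectionVars false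

/-! ### Preliminaries on star orders, the completely bounded norm and finite rank nets -/

/-- A ring carries at most one partial order that makes it a star-ordered ring. -/
lemma StarOrderedRing.partialOrder_unique {R : Type*} [NonUnitalSemiring R] [StarRing R]
    (o₁ o₂ : PartialOrder R) (h₁ : @StarOrderedRing R _ o₁ _) (h₂ : @StarOrderedRing R _ o₂ _) :
    o₁ = o₂ :=
  PartialOrder.ext fun x y => (@StarOrderedRing.le_iff R _ o₁ _ h₁ x y).trans
    (@StarOrderedRing.le_iff R _ o₂ _ h₂ x y).symm

/-- The bound that defines the completely bounded norm, for matrices over any finite index type. -/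
lemma enorm_map_le_cbNorm {A B : Type*}
    [NonUnitalCStarAlgebra A] [PartialOrder A] [StarOrderedRing A]
    [NonUnitalCStarAlgebra B] [PartialOrder B] [StarOrderedRing B] (φ : A →ₗ[ℂ] B)
    {ι : Type*} [Fintype ι] (M : CStarMatrix ι ι A) (hM : ‖M‖ ≤ 1) :
    ‖M.map φ‖ₑ ≤ cbNorm φ := by
  let e := Fintype.equivFin ι
  have hA : ‖CStarMatrix.reindexₐ ℂ A e M‖ = ‖M‖ :=
    NonUnitalStarAlgHom.norm_map (CStarMatrix.reindexₐ ℂ A e) (EquivLike.injective _) M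
  have hB : ‖CStarMatrix.reindexₐ ℂ B e (M.map φ)‖ = ‖M.map φ‖ :=
    NonUnitalStarAlgHom.norm_map (CStarMatrix.reindexₐ ℂ B e) (EquivLike.injective _) _
  have hmap : (CStarMatrix.reindexₐ ℂ A e M).map φ = CStarMatrix.reindexₐ ℂ B e (M.map φ) := rfl
  rw [← ofReal_norm, ← hB, ofReal_norm, ← hmap]
  exact le_iSup₂_of_le _ _ (le_iSup_of_le (hA.trans_le hM) le_rfl)

/-- A net as in `HasFiniteRankNet` may be built from approximations on finite sets. Its index set of
pairs of a finite subset of `A` and a tolerance lies in the universe of `A`, as the definition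
requires. -/
lemma HasFiniteRankNet.of_forall_finset {A : Type u} [NonUnitalCStarAlgebra A] {C : ℝ≥0}
    [o : PartialOrder A] [hA : StarOrderedRing A]
    (h : ∀ (F : Finset A) (ε : ℝ), 0 < ε → ∃ φ : A →ₗ[ℂ] A,
      FiniteDimensional ℂ (LinearMap.range φ) ∧ cbNorm φ ≤ C ∧ ∀ x ∈ F, ‖φ x - x‖ < ε) :
    HasFiniteRankNet A C := by
  classical
  obtain rfl := StarOrderedRing.partialOrder_unique o (CStarAlgebra.spectralOrder A) hA
    (CStarAlgebra.spectralOrderedRing A)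
  choose φ h1 h2 h3 using fun s : Finset A × ℕ => h s.1 _ (Nat.one_div_pos_of_nat (n := s.2))
  refine ⟨Finset A × ℕ, inferInstance, inferInstance, inferInstance, φ, h1, h2, fun x => ?_⟩
  refine squeeze_zero' (g := fun s : Finset A × ℕ => 1 / ((s.2 : ℝ) + 1))
    (.of_forall fun _ => norm_nonneg _) ?_ ?_
  · filter_upwards [Filter.eventually_ge_atTop (({x}, 0) : Finset A × ℕ)] with s hs
    exact (h3 s x (hs.1 (Finset.mem_singleton_self x))).le
  · exact tendsto_one_div_add_atTop_nhds_zero_nat.comp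
      (Filter.prod_atTop_atTop_eq (α := Finset A) (β := ℕ) ▸ Filter.tendsto_snd)

/-- `HasFiniteRankNet` in terms of a given order of the C⋆-algebra. -/
lemma HasFiniteRankNet.exists_net {A : Type u} [NonUnitalCStarAlgebra A] {C : ℝ≥0}
    [o : PartialOrder A] [hA : StarOrderedRing A] (h : HasFiniteRankNet A C) :
    ∃ (ι : Type u) (_ : Preorder ι) (_ : IsDirectedOrder ι) (_ : Nonempty ι) (φ : ι → A →ₗ[ℂ] A),
      (∀ i, FiniteDimensional ℂ (LinearMap.range (φ i))) ∧ (∀ i, cbNorm (φ i) ≤ C) ∧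
      ∀ x, Filter.Tendsto (fun i => ‖φ i x - x‖) Filter.atTop (nhds 0) := by
  obtain rfl := StarOrderedRing.partialOrder_unique o (CStarAlgebra.spectralOrder A) hA
    (CStarAlgebra.spectralOrderedRing A)
  exact h

namespace RightHilbert

open MulOpposite WithCStarModule Filter Topology

/-! ### Matrices of operators acting on `Hⁿ` -/

section Amplification

variable {B : Type*} [NonUnitalCStarAlgebra B] [PartialOrder B] [StarOrderedRing B]
variable {H : Type*} [NormedAddCommGroup H] [NormedSpace ℂ H] [SMul Bᵐᵒᵖ H] [CStarModule Bᵐᵒᵖ H]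
variable {ι : Type*} [Fintype ι]

variable (B) in
/-- The operator on `Hⁿ` given by an `n × n` matrix of operators on `H`. -/
def matrixCLM (M : ι → ι → H →L[ℂ] H) :
    C⋆ᵐᵒᵈ(Bᵐᵒᵖ, ι → H) →L[ℂ] C⋆ᵐᵒᵈ(Bᵐᵒᵖ, ι → H) :=
  let e : C⋆ᵐᵒᵈ(Bᵐᵒᵖ, ι → H) ≃L[ℂ] (ι → H) := equivL ℂ
  (e.symm : (ι → H) →L[ℂ] C⋆ᵐᵒᵈ(Bᵐᵒᵖ, ι → H)) ∘L
    ContinuousLinearMap.pi (fun k => ∑ l, M k l ∘L ContinuousLinearMap.proj l) ∘L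
    (e : C⋆ᵐᵒᵈ(Bᵐᵒᵖ, ι → H) →L[ℂ] (ι → H))

@[simp]
lemma matrixCLM_apply (M : ι → ι → H →L[ℂ] H) (h : C⋆ᵐᵒᵈ(Bᵐᵒᵖ, ι → H)) (k : ι) :
    matrixCLM B M h k = ∑ l, M k l (h l) := by
  simp [matrixCLM]

lemma isAdjoint_matrixCLM {M N : ι → ι → H →L[ℂ] H} (h : ∀ k l, IsAdjoint B (M k l) (N l k)) :
    IsAdjoint B (matrixCLM B M) (matrixCLM B N) := isAdjoint_iff.2 fun x y => by
  simp only [pi_inner, matrixCLM_apply, CStarModule.inner_sum_left, CStarModule.inner_sum_right]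
  rw [Finset.sum_comm]
  simp only [isAdjoint_iff.1 (h _ _)]

variable (B H ι) in
/-- The action of `M_n(L(H))` on the Hilbert module `Hⁿ`, as a star homomorphism into `L(Hⁿ)`. -/
def matrixHom : CStarMatrix ι ι (adjointable B H) →⋆ₙₐ[ℂ] adjointable B C⋆ᵐᵒᵈ(Bᵐᵒᵖ, ι → H) where
  toFun M := ⟨matrixCLM B fun k l => (M k l).1,
    ⟨_, isAdjoint_matrixCLM (N := fun k l => (star (M l k)).1) fun k l => isAdjoint_star (M k l)⟩⟩
  map_smul' c M := Subtype.ext <| ContinuousLinearMap.ext fun h => WithCStarModule.ext fun k => by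
    simp [Finset.smul_sum]
  map_zero' := Subtype.ext <| ContinuousLinearMap.ext fun h => WithCStarModule.ext fun k => by
    simp
  map_add' M N := Subtype.ext <| ContinuousLinearMap.ext fun h => WithCStarModule.ext fun k => by
    simp [Finset.sum_add_distrib]
  map_mul' M N := Subtype.ext <| ContinuousLinearMap.ext fun h => WithCStarModule.ext fun k => by
    simp only [matrixCLM_apply, CStarMatrix.mul_apply, map_sum, mul_apply_eq_comp,
      AddSubmonoidClass.coe_finsetSum, MulMemClass.coe_mul, sum_apply]
    exact Finset.sum_comm
  map_star' M := Subtype.ext <| Eq.symm <| coe_star_eq <|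
    isAdjoint_matrixCLM fun k l => by
      simpa [CStarMatrix.star_apply] using isAdjoint_star (M k l)

@[simp]
lemma matrixHom_apply (M : CStarMatrix ι ι (adjointable B H)) (h : C⋆ᵐᵒᵈ(Bᵐᵒᵖ, ι → H)) (k : ι) :
    (matrixHom B H ι M).1 h k = ∑ l, (M k l).1 (h l) :=
  matrixCLM_apply _ _ _

lemma matrixHom_injective : Function.Injective (matrixHom B H ι) := by
  classical
  refine (injective_iff_map_eq_zero _).2 fun M hM => ?_
  ext k l x
  have := matrixHom_apply M ((equiv Bᵐᵒᵖ (ι → H)).symm (Pi.single l x)) k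
  rw [hM, Finset.sum_eq_single l (fun j _ hj => by simp [hj]) (by simp)] at this
  simpa using this.symm

variable {D : Type*} [NonUnitalCStarAlgebra D] [PartialOrder D] [StarOrderedRing D]

/-- If `D` acts faithfully on `H`, then the norm of `M_n(D)` is the operator norm on `Hⁿ`. -/
lemma norm_matrixHom [CompleteSpace H] (ρ : D →⋆ₙₐ[ℂ] adjointable B H)
    (hρ : Function.Injective ρ) (M : CStarMatrix ι ι D) :
    ‖matrixHom B H ι (M.map ρ)‖ = ‖M‖ :=
  NonUnitalStarAlgHom.norm_map ((matrixHom B H ι).comp (CStarMatrix.mapₙₐ ρ))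
    (matrixHom_injective.comp (CStarMatrix.map_injective hρ)) M

end Amplification

/-! ### The operators `Bᵐ → H` given by vectors of `H` -/

section LeftMul

variable (B : Type*) [NonUnitalCStarAlgebra B] [PartialOrder B] [StarOrderedRing B]

/-- The left regular action of `B` on the right Hilbert module `B`, whose underlying type is `Bᵐᵒᵖ`
in the convention of `CStarModule`. -/
def leftMul : B →⋆ₙₐ[ℂ] adjointable B Bᵐᵒᵖ where
  toFun b := ⟨(ContinuousLinearMap.mul ℂ Bᵐᵒᵖ).flip (op b),
    (ContinuousLinearMap.mul ℂ Bᵐᵒᵖ).flip (op (star b)),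
    isAdjoint_iff.2 fun x y => by simp [inner_def, mul_assoc]⟩
  map_smul' c b := Subtype.ext <| by ext v; simp
  map_zero' := Subtype.ext <| by ext v; simp
  map_add' b c := Subtype.ext <| by ext v; simp
  map_mul' b c := Subtype.ext <| by ext v; simp [mul_assoc]
  map_star' b := Subtype.ext <| Eq.symm <| coe_star_eq <|
    isAdjoint_iff.2 fun x y => by simp [inner_def, mul_assoc]

variable {B}

@[simp]
lemma leftMul_apply (b : B) (v : Bᵐᵒᵖ) : (leftMul B b).1 v = v * op b := rfl

lemma leftMul_injective : Function.Injective (leftMul B) := by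
  refine (injective_iff_map_eq_zero _).2 fun b hb => ?_
  have h := leftMul_apply b (op (star b))
  rw [hb] at h
  have h' : op (b * star b) = 0 := by simpa using h.symm
  exact (CStarRing.mul_star_self_eq_zero_iff b).1 ((op_eq_zero_iff _).1 h')

end LeftMul

section Column

variable {B : Type*} [NonUnitalCStarAlgebra B] [PartialOrder B] [StarOrderedRing B]
variable {H : Type*} [NormedAddCommGroup H] [NormedSpace ℂ H] [SMul Bᵐᵒᵖ H] [CStarModule Bᵐᵒᵖ H]
variable {ι κ : Type*} [Fintype ι] [Fintype κ]

lemma sum_op_smul {σ : Type*} (s : Finset σ) (v : σ → Bᵐᵒᵖ) (x : H) :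
    (∑ i ∈ s, v i) • x = ∑ i ∈ s, v i • x :=
  ext_inner B fun z => by simp [Finset.sum_mul]

lemma mul_op_smul (v w : Bᵐᵒᵖ) (x : H) : (v * w) • x = v • w • x :=
  ext_inner B fun z => by simp [mul_assoc]

lemma norm_op_smul_le (v : Bᵐᵒᵖ) (x : H) : ‖v • x‖ ≤ ‖v‖ * ‖x‖ := by
  refine (abs_le_of_sq_le_sq' ?_ (by positivity)).2
  rw [CStarModule.norm_sq_eq Bᵐᵒᵖ, CStarModule.inner_op_smul_right, CStarModule.inner_op_smul_left]
  calc ‖v * (⟪x, x⟫_(Bᵐᵒᵖ) * star v)‖ ≤ ‖v‖ * (‖⟪x, x⟫_(Bᵐᵒᵖ)‖ * ‖star v‖) :=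
        (norm_mul_le _ _).trans (by gcongr; exact norm_mul_le _ _)
    _ = (‖v‖ * ‖x‖) ^ 2 := by rw [← CStarModule.norm_sq_eq Bᵐᵒᵖ, norm_star]; ring

/-- The map `Bⁿᵐ → Hⁿ`, `v ↦ (∑ i, x i · v (k, i))ₖ`, that is, `n` copies of the map `Bᵐ → H` given
by the row `(x 1, …, x m)` of vectors. -/
def rowMap (x : κ → H) (v : C⋆ᵐᵒᵈ(Bᵐᵒᵖ, ι × κ → Bᵐᵒᵖ)) : C⋆ᵐᵒᵈ(Bᵐᵒᵖ, ι → H) :=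
  (equiv Bᵐᵒᵖ (ι → H)).symm fun k => ∑ i, v (k, i) • x i

/-- The map `Hⁿ → Bⁿᵐ`, `h ↦ (⟨x i, h k⟩)₍ₖ,ᵢ₎`; it is the adjoint of `rowMap x`. -/
def rowMapAdjoint (x : κ → H) (h : C⋆ᵐᵒᵈ(Bᵐᵒᵖ, ι → H)) : C⋆ᵐᵒᵈ(Bᵐᵒᵖ, ι × κ → Bᵐᵒᵖ) :=
  (equiv Bᵐᵒᵖ (ι × κ → Bᵐᵒᵖ)).symm fun p => ⟪x p.2, h p.1⟫_(Bᵐᵒᵖ)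

@[simp]
lemma rowMap_apply (x : κ → H) (v : C⋆ᵐᵒᵈ(Bᵐᵒᵖ, ι × κ → Bᵐᵒᵖ)) (k : ι) :
    rowMap x v k = ∑ i, v (k, i) • x i := rfl

@[simp]
lemma rowMapAdjoint_apply (x : κ → H) (h : C⋆ᵐᵒᵈ(Bᵐᵒᵖ, ι → H)) (p : ι × κ) :
    rowMapAdjoint x h p = ⟪x p.2, h p.1⟫_(Bᵐᵒᵖ) := rfl

lemma inner_rowMap (x : κ → H) (v : C⋆ᵐᵒᵈ(Bᵐᵒᵖ, ι × κ → Bᵐᵒᵖ)) (h : C⋆ᵐᵒᵈ(Bᵐᵒᵖ, ι → H)) :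
    ⟪rowMap x v, h⟫_(Bᵐᵒᵖ) = ⟪v, rowMapAdjoint x h⟫_(Bᵐᵒᵖ) := by
  simp [pi_inner, Fintype.sum_prod_type, inner_def]

variable (B) in
/-- The positive operator `∑ i, θ_{x i, x i}`. -/
def frameOperator (x : κ → H) : adjointable B H := ∑ i, theta B (x i) (x i)

lemma frameOperator_apply (x : κ → H) (h : H) :
    (frameOperator B x).1 h = ∑ i, ⟪x i, h⟫_(Bᵐᵒᵖ) • x i := by
  simp [frameOperator, theta, thetaCLM_apply, rightInner]

lemma inner_frameOperator (x : κ → H) (h : H) :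
    ⟪h, (frameOperator B x).1 h⟫_(Bᵐᵒᵖ) = ∑ i, ⟪x i, h⟫_(Bᵐᵒᵖ) * ⟪h, x i⟫_(Bᵐᵒᵖ) := by
  simp [frameOperator_apply]

/-- `rowMapAdjoint x` is a contraction if `∑ i, θ_{x i, x i}` is. -/
lemma norm_rowMapAdjoint_le [CompleteSpace H] {x : κ → H} (hx : ‖frameOperator B x‖ ≤ 1)
    (h : C⋆ᵐᵒᵈ(Bᵐᵒᵖ, ι → H)) : ‖rowMapAdjoint x h‖ ≤ ‖h‖ := by
  classical
  -- The diagonal embedding of `L(H)` into `L(Hⁿ)`: a star homomorphism, hence contractive.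
  let δ : adjointable B H →⋆ₙₐ[ℂ] CStarMatrix ι ι (adjointable B H) :=
    { toFun := fun T => CStarMatrix.ofMatrix (Matrix.diagonal fun _ => T)
      map_smul' := fun c T => by
        ext k l : 2; by_cases hkl : k = l <;> simp [Matrix.diagonal, hkl]
      map_zero' := by ext k l : 2; by_cases hkl : k = l <;> simp [Matrix.diagonal, hkl]
      map_add' := fun S T => by
        ext k l : 2; by_cases hkl : k = l <;> simp [Matrix.diagonal, hkl]
      map_mul' := fun S T => by
        ext k l : 2
        by_cases hkl : k = l <;> simp [Matrix.diagonal, CStarMatrix.mul_apply, hkl]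
      map_star' := fun T => by
        ext k l : 2
        by_cases hkl : k = l <;> simp [Matrix.diagonal, CStarMatrix.star_apply, hkl, eq_comm] }
  have hδ : ∀ T k, ((matrixHom B H ι).comp δ T).1 h k = T.1 (h k) := fun T k => by
    rw [NonUnitalStarAlgHom.comp_apply, matrixHom_apply, Finset.sum_eq_single k]
    · simp [δ]
    · intro l _ hl
      simp [δ, Matrix.diagonal, hl.symm]
    · simp
  set E := (matrixHom B H ι).comp δ (frameOperator B x) with hE
  have hEn : ‖E‖ ≤ 1 := (NonUnitalStarAlgHom.norm_apply_le _ _).trans hx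
  have hin : ⟪rowMapAdjoint x h, rowMapAdjoint x h⟫_(Bᵐᵒᵖ) = ⟪h, E.1 h⟫_(Bᵐᵒᵖ) := by
    simp only [pi_inner, hE, hδ, inner_frameOperator, Fintype.sum_prod_type, rowMapAdjoint_apply,
      inner_def, CStarModule.star_inner]
  refine (abs_le_of_sq_le_sq' ?_ (norm_nonneg _)).2
  rw [CStarModule.norm_sq_eq Bᵐᵒᵖ, hin, sq]
  refine (CStarModule.norm_inner_le _).trans ?_
  gcongr
  exact E.1.le_of_opNorm_le hEn h |>.trans_eq (one_mul _)

/-- `rowMap x` is a contraction if `∑ i, θ_{x i, x i}` is. -/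
lemma norm_rowMap_le [CompleteSpace H] {x : κ → H} (hx : ‖frameOperator B x‖ ≤ 1)
    (v : C⋆ᵐᵒᵈ(Bᵐᵒᵖ, ι × κ → Bᵐᵒᵖ)) : ‖rowMap x v‖ ≤ ‖v‖ := by
  rcases (norm_nonneg (rowMap x v)).eq_or_lt with h0 | h0
  · exact h0 ▸ norm_nonneg v
  refine le_of_mul_le_mul_right ?_ h0
  calc ‖rowMap x v‖ * ‖rowMap x v‖ = ‖⟪v, rowMapAdjoint x (rowMap x v)⟫_(Bᵐᵒᵖ)‖ := by
        rw [← sq, CStarModule.norm_sq_eq Bᵐᵒᵖ, inner_rowMap]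
    _ ≤ ‖v‖ * ‖rowMapAdjoint x (rowMap x v)‖ := CStarModule.norm_inner_le _
    _ ≤ ‖v‖ * ‖rowMap x v‖ := by gcongr; exact norm_rowMapAdjoint_le hx _

end Column

/-! ### Compressing maps on `B` to maps on `K(H)` -/

section Compression

variable {B : Type*} [NonUnitalCStarAlgebra B] [PartialOrder B] [StarOrderedRing B]
variable {H : Type*} [NormedAddCommGroup H] [NormedSpace ℂ H] [SMul Bᵐᵒᵖ H] [CStarModule Bᵐᵒᵖ H]

lemma norm_apply_le (T : adjointable B H) (h : H) : ‖T.1 h‖ ≤ ‖T‖ * ‖h‖ :=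
  T.1.le_opNorm h

lemma norm_le_of_forall_apply_le {T : adjointable B H} {C : ℝ} (hC : 0 ≤ C)
    (h : ∀ x, ‖T.1 x‖ ≤ C * ‖x‖) : ‖T‖ ≤ C :=
  T.1.opNorm_le_bound hC h

lemma norm_theta_le (x y : H) : ‖theta B x y‖ ≤ ‖x‖ * ‖y‖ :=
  ContinuousLinearMap.opNorm_le_bound _ (by positivity) fun h => by
    calc ‖⟪y, h⟫_(Bᵐᵒᵖ) • x‖ ≤ ‖⟪y, h⟫_(Bᵐᵒᵖ)‖ * ‖x‖ := norm_op_smul_le _ _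
      _ ≤ ‖y‖ * ‖h‖ * ‖x‖ := by gcongr; exact CStarModule.norm_inner_le H
      _ = ‖x‖ * ‖y‖ * ‖h‖ := by ring

lemma theta_add_left (x x' y : H) : theta B (x + x') y = theta B x y + theta B x' y :=
  Subtype.ext <| ContinuousLinearMap.ext fun h => ext_inner B fun z => by
    simp [theta, thetaCLM_apply, mul_add]

lemma theta_smul_left (c : ℂ) (x y : H) : theta B (c • x) y = c • theta B x y :=
  Subtype.ext <| ContinuousLinearMap.ext fun h => ext_inner B fun z => by
    simp [theta, thetaCLM_apply, mul_smul_comm]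

lemma theta_sum_left {σ : Type*} (s : Finset σ) (x : σ → H) (y : H) :
    theta B (∑ i ∈ s, x i) y = ∑ i ∈ s, theta B (x i) y :=
  map_sum (AddMonoidHom.mk' (fun x => theta B x y) fun x x' => theta_add_left x x' y) x s

variable [CompleteSpace H]

lemma theta_mem_compactOperators (x y : H) : theta B x y ∈ compactOperators B H :=
  subset_closure (Submodule.subset_span ⟨x, y, rfl⟩)

variable (B) in
/-- The map `b ↦ θ_{x · b, y}` from `B` to `K(H)`. -/
def thetaSMul (x y : H) : B →L[ℂ] compactOperators B H :=
  LinearMap.mkContinuous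
    { toFun := fun b => ⟨theta B (op b • x) y, theta_mem_compactOperators _ _⟩
      map_add' := fun b c => Subtype.ext <|
        (congrArg (theta B · y) (ext_inner B fun z => by simp [add_mul])).trans
          (theta_add_left (op b • x) (op c • x) y)
      map_smul' := fun c b => Subtype.ext <|
        (congrArg (theta B · y) (ext_inner B fun z => by simp [smul_mul_assoc])).trans
          (theta_smul_left c (op b • x) y) } (‖x‖ * ‖y‖) fun b => by
    refine (norm_theta_le _ _).trans ?_
    have := norm_op_smul_le (op b) x
    rw [norm_op] at this
    calc ‖op b • x‖ * ‖y‖ ≤ ‖b‖ * ‖x‖ * ‖y‖ := by gcongr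
      _ = ‖x‖ * ‖y‖ * ‖b‖ := by ring

@[simp]
lemma coe_thetaSMul (x y : H) (b : B) :
    (thetaSMul B x y b : adjointable B H) = theta B (op b • x) y := rfl

variable (B) in
/-- The matrix coefficient `T ↦ ⟨x, T y⟩` from `K(H)` to `B`. -/
def coefficient (x y : H) : compactOperators B H →ₗ[ℂ] B where
  toFun T := rightInner B x (T.1.1 y)
  map_add' S T := by simp [rightInner]
  map_smul' c T := by simp [rightInner]

lemma op_coefficient (x y : H) (T : compactOperators B H) :
    op (coefficient B x y T) = ⟪x, T.1.1 y⟫_(Bᵐᵒᵖ) := rfl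

variable {κ : Type*} [Fintype κ]

/-- The composition `K(H) → M_m(B) → M_m(B) → K(H)` of `T ↦ (⟨x i, T (x j)⟩)ᵢⱼ`, of `φ` applied to
the entries, and of `b ↦ ∑ i j, θ_{x i · b i j, x j}`. -/
def compressed (x : κ → H) (φ : B →ₗ[ℂ] B) : compactOperators B H →ₗ[ℂ] compactOperators B H :=
  ∑ i, ∑ j, (thetaSMul B (x i) (x j)).toLinearMap ∘ₗ φ ∘ₗ coefficient B (x i) (x j)

lemma compressed_apply (x : κ → H) (φ : B →ₗ[ℂ] B) (T : compactOperators B H) :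
    compressed x φ T =
      ∑ i, ∑ j, thetaSMul B (x i) (x j) (φ (coefficient B (x i) (x j) T)) := by
  simp [compressed]

lemma coe_compressed_id (x : κ → H) (T : compactOperators B H) :
    (compressed x LinearMap.id T : adjointable B H) =
      frameOperator B x * T * frameOperator B x := by
  set e := frameOperator B x with he
  rw [compressed_apply, Finset.sum_comm]
  conv_rhs => rw [he, frameOperator, Finset.mul_sum]
  simp only [AddSubmonoidClass.coe_finsetSum, coe_thetaSMul, LinearMap.id_apply, op_coefficient,
    ← theta_sum_left, ← frameOperator_apply, mul_theta]
  rfl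

lemma finiteDimensional_range_sum {V W σ : Type*} [AddCommGroup V] [Module ℂ V] [AddCommGroup W]
    [Module ℂ W] (s : Finset σ) (f : σ → V →ₗ[ℂ] W)
    (hf : ∀ i ∈ s, FiniteDimensional ℂ (LinearMap.range (f i))) :
    FiniteDimensional ℂ (LinearMap.range (∑ i ∈ s, f i)) := by
  have : ∀ i : s, FiniteDimensional ℂ (LinearMap.range (f i)) := fun i => hf i i.2
  refine Submodule.finiteDimensional_of_le (S₂ := ⨆ i : s, LinearMap.range (f i)) ?_
  rintro _ ⟨v, rfl⟩
  rw [LinearMap.sum_apply]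
  exact Submodule.sum_mem _ fun i hi =>
    Submodule.mem_iSup_of_mem (p := fun i : s => LinearMap.range (f i)) ⟨i, hi⟩ ⟨v, rfl⟩

lemma finiteDimensional_range_compressed (x : κ → H) (φ : B →ₗ[ℂ] B)
    [FiniteDimensional ℂ (LinearMap.range φ)] :
    FiniteDimensional ℂ (LinearMap.range (compressed x φ)) := by
  refine finiteDimensional_range_sum _ _ fun i _ => finiteDimensional_range_sum _ _ fun j _ => ?_
  refine Submodule.finiteDimensional_of_le
    (S₂ := (LinearMap.range φ).map (thetaSMul B (x i) (x j)).toLinearMap) ?_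
  rintro _ ⟨T, rfl⟩
  exact ⟨_, ⟨_, rfl⟩, rfl⟩

variable [PartialOrder (compactOperators B H)] [StarOrderedRing (compactOperators B H)]

variable {ι : Type*} [Fintype ι]

lemma norm_matrix_compactOperators (M : CStarMatrix ι ι (compactOperators B H)) :
    ‖matrixHom B H ι (M.map Subtype.val)‖ = ‖M‖ :=
  norm_matrixHom (NonUnitalStarSubalgebraClass.subtype (compactOperators B H))
    Subtype.val_injective M

/-- The map `T ↦ (⟨x i, T (x j)⟩)ᵢⱼ` from `K(H)` to `M_m(B)` is `T ↦ X* T X` with the contraction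
`X = rowMap x`, so it is completely contractive. -/
lemma norm_coefficient_matrix_le {x : κ → H} (hx : ‖frameOperator B x‖ ≤ 1)
    (M : CStarMatrix ι ι (compactOperators B H)) :
    ‖(CStarMatrix.ofMatrix fun p q => coefficient B (x p.2) (x q.2) (M p.1 q.1) :
      CStarMatrix (ι × κ) (ι × κ) B)‖ ≤ ‖M‖ := by
  rw [← norm_matrixHom (leftMul B) leftMul_injective, ← norm_matrix_compactOperators]
  refine norm_le_of_forall_apply_le (norm_nonneg _) fun v => ?_
  have key : (matrixHom B Bᵐᵒᵖ _ ((CStarMatrix.ofMatrix fun p q =>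
        coefficient B (x p.2) (x q.2) (M p.1 q.1) :
          CStarMatrix (ι × κ) (ι × κ) B).map (leftMul B))).1 v =
      rowMapAdjoint x ((matrixHom B H _ (M.map Subtype.val)).1 (rowMap x v)) := by
    refine WithCStarModule.ext fun p => ?_
    simp only [matrixHom_apply, CStarMatrix.map_apply, leftMul_apply, rowMapAdjoint_apply,
      CStarModule.inner_sum_right, rowMap_apply, map_sum, Fintype.sum_prod_type]
    refine Finset.sum_congr rfl fun l _ => Finset.sum_congr rfl fun j _ => ?_
    have := (isAdjoint_star (M p.1 l).1).map_op_smul (unop (v (l, j))) (x j)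
    rw [op_unop] at this
    rw [this, CStarModule.inner_op_smul_right]
    rfl
  rw [key]
  refine (norm_rowMapAdjoint_le hx _).trans ((norm_apply_le _ _).trans ?_)
  gcongr
  exact norm_rowMap_le hx v

/-- The map `b ↦ ∑ i j, θ_{x i · b i j, x j}` from `M_m(B)` to `K(H)` is `b ↦ X b X*` with the
contraction `X = rowMap x`, so it is completely contractive. -/
lemma norm_sum_thetaSMul_matrix_le {x : κ → H} (hx : ‖frameOperator B x‖ ≤ 1)
    (N : CStarMatrix (ι × κ) (ι × κ) B) :
    ‖(CStarMatrix.ofMatrix fun k l => ∑ i, ∑ j, thetaSMul B (x i) (x j) (N (k, i) (l, j)) :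
      CStarMatrix ι ι (compactOperators B H))‖ ≤ ‖N‖ := by
  rw [← norm_matrixHom (leftMul B) leftMul_injective, ← norm_matrix_compactOperators]
  refine norm_le_of_forall_apply_le (norm_nonneg _) fun h => ?_
  have key : (matrixHom B H _ ((CStarMatrix.ofMatrix fun k l =>
        ∑ i, ∑ j, thetaSMul B (x i) (x j) (N (k, i) (l, j)) :
          CStarMatrix ι ι (compactOperators B H)).map Subtype.val)).1 h =
      rowMap x ((matrixHom B Bᵐᵒᵖ _ (N.map (leftMul B))).1 (rowMapAdjoint x h)) := by
    refine WithCStarModule.ext fun k => ?_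
    simp only [matrixHom_apply, CStarMatrix.map_apply, leftMul_apply, rowMapAdjoint_apply,
      rowMap_apply, Fintype.sum_prod_type, sum_op_smul, mul_op_smul]
    rw [Finset.sum_comm]
    refine Finset.sum_congr rfl fun l _ => ?_
    change (∑ i, ∑ j, thetaSMul B (x i) (x j) (N (k, i) (l, j))).1.1 (h l) = _
    simp only [AddSubmonoidClass.coe_finsetSum, sum_apply]
    rfl
  rw [key]
  refine (norm_rowMap_le hx _).trans ((norm_apply_le _ _).trans ?_)
  gcongr
  exact norm_rowMapAdjoint_le hx h

/-- As `φ` is sandwiched between two completely contractive maps, the completely bounded norm does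
not grow. -/
lemma cbNorm_compressed_le {x : κ → H} (hx : ‖frameOperator B x‖ ≤ 1) (φ : B →ₗ[ℂ] B) :
    cbNorm (compressed (B := B) (H := H) x φ) ≤ cbNorm φ := by
  refine iSup_le fun n => iSup₂_le fun M hM => ?_
  let N : CStarMatrix (Fin n × κ) (Fin n × κ) B :=
    CStarMatrix.ofMatrix fun p q => coefficient B (x p.2) (x q.2) (M p.1 q.1)
  have hN : ‖N‖ ≤ 1 := (norm_coefficient_matrix_le hx M).trans hM
  have hM' : M.map (compressed x φ) = CStarMatrix.ofMatrix fun k l =>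
      ∑ i, ∑ j, thetaSMul B (x i) (x j) (N.map φ (k, i) (l, j)) :=
    CStarMatrix.ext fun k l => compressed_apply x φ (M k l)
  refine le_trans ?_ (enorm_map_le_cbNorm φ N hN)
  rw [hM', ← ofReal_norm, ← ofReal_norm]
  exact ENNReal.ofReal_le_ofReal (norm_sum_thetaSMul_matrix_le hx _)

end Compression

/-! ### Approximate units of `K(H)` -/

section ApproximateUnit

variable {B : Type*} [NonUnitalCStarAlgebra B] [PartialOrder B] [StarOrderedRing B]
variable {H : Type*} [NormedAddCommGroup H] [NormedSpace ℂ H] [SMul Bᵐᵒᵖ H] [CStarModule Bᵐᵒᵖ H]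
variable {κ : Type*} [Fintype κ]

lemma star_frameOperator (x : κ → H) : star (frameOperator B x) = frameOperator B x := by
  simp [frameOperator, star_theta]

lemma frameOperator_map (T : adjointable B H) (x : κ → H) :
    frameOperator B (fun i => T.1 (x i)) = T * frameOperator B x * star T := by
  simp only [frameOperator, Finset.mul_sum, Finset.sum_mul, mul_theta, theta_mul, star_star]

lemma inner_frameOperator_nonneg (x : κ → H) (h : H) :
    0 ≤ ⟪h, (frameOperator B x).1 h⟫_(Bᵐᵒᵖ) := by
  rw [inner_frameOperator]
  refine Finset.sum_nonneg fun i _ => ?_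
  rw [← CStarModule.star_inner (x i) h]
  exact mul_star_self_nonneg _

variable [CompleteSpace H]

/-- `⟨x i, x i⟩² ≤ ∑ j, ⟨x i, x j⟩ ⟨x j, x i⟩ = ⟨x i, T (x i)⟩` for `T = ∑ j, θ_{x j, x j}`. -/
lemma sq_norm_le_norm_frameOperator (x : κ → H) (i : κ) : ‖x i‖ ^ 2 ≤ ‖frameOperator B x‖ := by
  rcases (norm_nonneg (x i)).eq_or_lt with h0 | h0
  · rw [← h0]; simp
  have h1 : ‖⟪x i, x i⟫_(Bᵐᵒᵖ) * ⟪x i, x i⟫_(Bᵐᵒᵖ)‖ ≤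
      ‖⟪x i, (frameOperator B x).1 (x i)⟫_(Bᵐᵒᵖ)‖ := by
    have hnn : ∀ j, 0 ≤ ⟪x j, x i⟫_(Bᵐᵒᵖ) * ⟪x i, x j⟫_(Bᵐᵒᵖ) := fun j => by
      rw [← CStarModule.star_inner (x j) (x i)]
      exact mul_star_self_nonneg _
    refine CStarAlgebra.norm_le_norm_of_nonneg_of_le (hnn i) ?_
    rw [inner_frameOperator]
    exact Finset.single_le_sum (fun j _ => hnn j) (Finset.mem_univ i)
  have h2 : ‖⟪x i, x i⟫_(Bᵐᵒᵖ) * ⟪x i, x i⟫_(Bᵐᵒᵖ)‖ = ‖x i‖ ^ 2 * ‖x i‖ ^ 2 := by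
    conv_lhs => enter [1, 1]; rw [← CStarModule.star_inner]
    rw [CStarRing.norm_star_mul_self, ← CStarModule.norm_sq_eq Bᵐᵒᵖ]
  have h3 : ‖⟪x i, (frameOperator B x).1 (x i)⟫_(Bᵐᵒᵖ)‖ ≤ ‖x i‖ ^ 2 * ‖frameOperator B x‖ := by
    refine (CStarModule.norm_inner_le _).trans ?_
    rw [sq, mul_assoc, mul_comm ‖x i‖ ‖frameOperator B x‖]
    gcongr
    exact (frameOperator B x).1.le_opNorm _
  exact le_of_mul_le_mul_left (h2 ▸ h1.trans h3) (by positivity)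

/-- If `⟨h, a h⟩ ≥ 0` for all `h`, then the self-adjoint operator `a` has no negative spectrum. -/
lemma spectrum_nonneg_of_inner_nonneg {a : adjointable B H} (ha : IsSelfAdjoint a)
    (hpos : ∀ h, 0 ≤ ⟪h, a.1 h⟫_(Bᵐᵒᵖ)) {t : ℝ} (ht : t ∈ spectrum ℝ a) : 0 ≤ t := by
  -- With `w` the square root of the negative part of `a`, one has `w a w = -w⁴`.
  set n : ℝ → ℝ := fun t => √(max (-t) 0) with hn
  have hnc : Continuous n := by fun_prop
  have hn2 : ∀ t, n t * n t = max (-t) 0 := fun t => Real.mul_self_sqrt (le_max_right _ _)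
  set w := cfc n a with hw
  have hws : star w = w := (cfc_predicate n a : IsSelfAdjoint w)
  have hwaw : w * a * w = -((w * w) * (w * w)) := by
    conv_lhs => enter [1, 2]; rw [← cfc_id ℝ a]
    rw [← cfc_mul .., ← cfc_mul .., ← cfc_mul .., ← cfc_mul .., ← cfc_neg ..]
    refine cfc_congr fun s _ => ?_
    simp only [id, hn2]
    rw [mul_right_comm, hn2]
    rcases le_total s 0 with h | h
    · rw [max_eq_left (by linarith)]; ring
    · rw [max_eq_right (by linarith)]; ring
  have hww : w * w = 0 := by
    ext h
    have h1 : ⟪h, (w * a * w).1 h⟫_(Bᵐᵒᵖ) = -⟪(w * w).1 h, (w * w).1 h⟫_(Bᵐᵒᵖ) := by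
      have := isAdjoint_iff.1 (isAdjoint_star (w * w)) h ((w * w).1 h)
      rw [this, star_mul, hws, hwaw]
      exact CStarModule.inner_neg_right
    have h2 : 0 ≤ ⟪h, (w * a * w).1 h⟫_(Bᵐᵒᵖ) := by
      have := isAdjoint_iff.1 (isAdjoint_star w) h (a.1 (w.1 h))
      rw [hws] at this
      exact (hpos (w.1 h)).trans_eq this
    rw [h1, neg_nonneg] at h2
    exact CStarModule.inner_self.1 (le_antisymm h2 CStarModule.inner_self_nonneg)
  rw [hw, ← cfc_mul .., ← cfc_zero ℝ a] at hww
  have hEq : Set.EqOn (fun t => n t * n t) 0 (spectrum ℝ a) :=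
    (cfc_eq_cfc_iff_eqOn ha (hnc.mul hnc).continuousOn continuous_zero.continuousOn).1 hww
  have h0 : max (-t) 0 = 0 := (hn2 t).symm.trans (hEq ht)
  linarith [le_max_left (-t) 0]

/-- With `a = ∑ θ_{y i, y i}`, the vectors `x i = (a + δ)^(-1/2) (y i)` have
`e := ∑ θ_{x i, x i} = a (a + δ)⁻¹ ≤ 1`, and `‖(1 - e) (y i)‖² ≤ ‖(1 - e) a (1 - e)‖ ≤ δ`. -/
lemma exists_frameOperator_approx (y : κ → H) {δ : ℝ} (hδ : 0 < δ) :
    ∃ x : κ → H, ‖frameOperator B x‖ ≤ 1 ∧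
      ∀ i, ‖(frameOperator B x).1 (y i) - y i‖ ^ 2 ≤ δ := by
  set a := frameOperator B y with ha_def
  have ha : IsSelfAdjoint a := star_frameOperator y
  have hspec : ∀ t ∈ spectrum ℝ a, 0 ≤ t := fun t =>
    spectrum_nonneg_of_inner_nonneg ha (inner_frameOperator_nonneg y)
  set g : ℝ → ℝ := fun t => (√(t + δ))⁻¹ with hg
  have hgc : ContinuousOn g (spectrum ℝ a) := by
    refine ContinuousOn.inv₀ (by fun_prop) fun t ht => ?_
    have := hspec t ht
    positivity
  have hgg : ∀ t ∈ spectrum ℝ a, g t * t * g t = t / (t + δ) := fun t ht => by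
    have h0 := hspec t ht
    rw [hg, mul_right_comm, ← mul_inv, Real.mul_self_sqrt (by positivity)]
    field_simp
  set p := cfc g a with hp
  have hps : star p = p := (cfc_predicate g a : IsSelfAdjoint p)
  have hf : frameOperator B (fun i => p.1 (y i)) = cfc (fun t => g t * t * g t) a := by
    rw [frameOperator_map, ← ha_def, hps, cfc_mul .., cfc_mul .., cfc_id' ℝ a]
  refine ⟨fun i => p.1 (y i), ?_, fun i => ?_⟩
  · rw [hf]
    refine norm_cfc_le zero_le_one fun t ht => ?_
    have h0 := hspec t ht
    rw [hgg t ht, Real.norm_of_nonneg (by positivity)]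
    exact div_le_one_of_le₀ (by linarith) (by positivity)
  · set e := frameOperator B (fun i => p.1 (y i)) with he
    have hes : star (e - 1) = e - 1 := by rw [star_sub, he, star_frameOperator, star_one]
    have h1 := sq_norm_le_norm_frameOperator (B := B) (fun i => (e - 1).1 (y i)) i
    rw [frameOperator_map, ← ha_def, hes] at h1
    refine h1.trans ?_
    have h2 : (e - 1) * a * (e - 1) =
        cfc (fun t => (g t * t * g t - 1) * t * (g t * t * g t - 1)) a := by
      rw [cfc_mul .., cfc_mul .., cfc_sub .., cfc_id' ℝ a, cfc_const_one ℝ a, hf]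
    rw [h2]
    refine norm_cfc_le hδ.le fun t ht => ?_
    have h0 := hspec t ht
    rw [hgg t ht, show (t / (t + δ) - 1) * t * (t / (t + δ) - 1) =
      δ * ((δ / (t + δ)) * (t / (t + δ))) by field_simp; ring, Real.norm_of_nonneg (by positivity)]
    refine mul_le_of_le_one_right hδ.le (mul_le_one₀ ?_ (by positivity) ?_) <;>
      exact div_le_one_of_le₀ (by linarith) (by positivity)

/-- A bounded net of self-adjoint operators that tends to the identity pointwise on `H` is an
approximate unit of `K(H)`. -/
lemma tendsto_mul_compactOperators {σ : Type*} {l : Filter σ} {e : σ → adjointable B H}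
    (hn : ∀ s, ‖e s‖ ≤ 1) (hs : ∀ s, star (e s) = e s)
    (he : ∀ h, Tendsto (fun s => (e s).1 h) l (𝓝 h)) {T : adjointable B H}
    (hT : T ∈ compactOperators B H) : Tendsto (fun s => e s * T * e s) l (𝓝 T) := by
  have hleft : ∀ T ∈ compactOperators B H, Tendsto (fun s => e s * T) l (𝓝 T) := by
    have hspan : ∀ T ∈ thetaSpan B H, Tendsto (fun s => e s * T) l (𝓝 T) := fun T hT => by
      induction hT using Submodule.span_induction with
      | mem T h =>
        obtain ⟨x, y, rfl⟩ := h
        rw [tendsto_iff_norm_sub_tendsto_zero]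
        refine squeeze_zero (g := fun s => ‖(e s).1 x - x‖ * ‖y‖) (fun _ => norm_nonneg _)
          (fun s => ?_) ?_
        · have : e s * theta B x y - theta B x y = theta B ((e s).1 x - x) y := by
            rw [mul_theta, sub_eq_iff_eq_add, ← theta_add_left, sub_add_cancel]
          rw [this]
          exact norm_theta_le _ _
        · simpa using (tendsto_iff_norm_sub_tendsto_zero.1 (he x)).mul_const ‖y‖
      | zero => simpa using tendsto_const_nhds
      | add S T _ _ h h' => simpa [mul_add] using h.add h'
      | smul c T _ h => simpa using h.const_smul c
    intro T hT
    rw [Metric.tendsto_nhds]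
    intro ε hε
    obtain ⟨S, hS, hST⟩ := Metric.mem_closure_iff.1 hT (ε / 3) (by positivity)
    filter_upwards [Metric.tendsto_nhds.1 (hspan S hS) (ε / 3) (by positivity)] with s hsS
    rw [dist_eq_norm] at *
    calc ‖e s * T - T‖ = ‖e s * (T - S) + (e s * S - S) + (S - T)‖ := by
          congr 1; noncomm_ring
      _ ≤ ‖e s * (T - S)‖ + ‖e s * S - S‖ + ‖S - T‖ := norm_add₃_le
      _ < ε / 3 + ε / 3 + ε / 3 := by
          have h1 : ‖e s * (T - S)‖ < ε / 3 :=
            lt_of_le_of_lt ((norm_mul_le _ _).trans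
              (mul_le_of_le_one_left (norm_nonneg _) (hn s))) hST
          rw [norm_sub_rev S T]
          gcongr
      _ = ε := by ring
  have hright : Tendsto (fun s => T * e s) l (𝓝 T) := by
    have := (hleft (star T) (star_mem hT)).star
    simpa [hs] using this
  rw [tendsto_iff_norm_sub_tendsto_zero]
  refine squeeze_zero (g := fun s => ‖e s * T - T‖ + ‖T * e s - T‖) (fun _ => norm_nonneg _)
    (fun s => ?_) ?_
  · calc ‖e s * T * e s - T‖ = ‖(e s) * (T * e s - T) + (e s * T - T)‖ := by
          congr 1; noncomm_ring
      _ ≤ ‖e s * (T * e s - T)‖ + ‖e s * T - T‖ := norm_add_le _ _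
      _ ≤ ‖T * e s - T‖ + ‖e s * T - T‖ := by
          gcongr
          exact (norm_mul_le _ _).trans (mul_le_of_le_one_left (norm_nonneg _) (hn s))
      _ = _ := add_comm _ _
  · simpa using (tendsto_iff_norm_sub_tendsto_zero.1 (hleft T hT)).add
      (tendsto_iff_norm_sub_tendsto_zero.1 hright)

/-- `K(H)` has approximate units of the form `∑ i, θ_{x i, x i}`. -/
lemma exists_frameOperator_mul_mul_approx (F : Finset (compactOperators B H)) {ε : ℝ}
    (hε : 0 < ε) :
    ∃ (Y : Finset H) (x : Y → H), ‖frameOperator B x‖ ≤ 1 ∧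
      ∀ T ∈ F, ‖frameOperator B x * T * frameOperator B x - T‖ < ε := by
  classical
  -- A net indexed by the pairs of a finite set of vectors and a tolerance.
  choose x hx1 hx2 using fun s : Finset H × ℕ =>
    exists_frameOperator_approx (B := B) (fun y : s.1 => (y : H))
      (Nat.one_div_pos_of_nat (n := s.2))
  have he : ∀ h, Tendsto (fun s => (frameOperator B (x s)).1 h) atTop (𝓝 h) := fun h => by
    have hz : Tendsto (fun s => ‖(frameOperator B (x s)).1 h - h‖ ^ 2) atTop (𝓝 0) := by
      refine squeeze_zero' (g := fun s : Finset H × ℕ => 1 / ((s.2 : ℝ) + 1))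
        (.of_forall fun _ => by positivity) ?_ ?_
      · filter_upwards [eventually_ge_atTop (({h}, 0) : Finset H × ℕ)] with s hs
        exact hx2 s ⟨h, hs.1 (Finset.mem_singleton_self h)⟩
      · exact tendsto_one_div_add_atTop_nhds_zero_nat.comp
          (prod_atTop_atTop_eq (α := Finset H) (β := ℕ) ▸ tendsto_snd)
    rw [tendsto_iff_norm_sub_tendsto_zero]
    simpa using hz.sqrt
  have := (Filter.eventually_all_finset F).2 fun T _ => Metric.tendsto_nhds.1
    (tendsto_mul_compactOperators hx1 (fun s => star_frameOperator (x s)) he T.2) ε hε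
  obtain ⟨s, hs⟩ := this.exists
  exact ⟨s.1, x s, hx1 s, fun T hT => by simpa [dist_eq_norm] using hs T hT⟩

lemma tendsto_compressed (x : κ → H) {σ : Type*} {l : Filter σ} {φ : σ → B →ₗ[ℂ] B}
    (hφ : ∀ b, Tendsto (fun s => φ s b) l (𝓝 b)) (T : compactOperators B H) :
    Tendsto (fun s => compressed x (φ s) T) l (𝓝 (compressed x LinearMap.id T)) := by
  simp only [compressed_apply]
  refine tendsto_finsetSum _ fun i _ => tendsto_finsetSum _ fun j _ => ?_
  exact ((thetaSMul B (x i) (x j)).continuous.tendsto _).comp (hφ _)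

lemma eventually_norm_compressed_sub_lt {x : κ → H} {σ : Type*} {l : Filter σ} {φ : σ → B →ₗ[ℂ] B}
    (hφ : ∀ b, Tendsto (fun s => φ s b) l (𝓝 b)) {T : compactOperators B H} {ε : ℝ}
    (hT : ‖frameOperator B x * T * frameOperator B x - T‖ < ε) :
    ∀ᶠ s in l, ‖compressed x (φ s) T - T‖ < ε := by
  rw [← coe_compressed_id] at hT
  have h : Tendsto (fun s => ‖compressed x (φ s) T - T‖) l
      (𝓝 ‖compressed x LinearMap.id T - T‖) :=
    ((tendsto_compressed x hφ T).sub_const T).norm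
  exact h.eventually_lt_const hT

end ApproximateUnit

/-! ### Finite rank approximations on `K(H)` -/

set_option maxHeartbeats 800000 in
/-- The maps `compressed x φ`, with `φ` from a finite rank net of `B`, approximate the identity of
`K(H)` on finite sets. -/
lemma _root_.HasFiniteRankNet.exists_approx_compactOperators {B : Type u} [NonUnitalCStarAlgebra B]
    [PartialOrder B] [StarOrderedRing B] {H : Type v} [NormedAddCommGroup H] [NormedSpace ℂ H]
    [CompleteSpace H] [SMul Bᵐᵒᵖ H] [CStarModule Bᵐᵒᵖ H]
    [PartialOrder (compactOperators B H)]
    [StarOrderedRing (compactOperators B H)] {C : ℝ≥0} (h : HasFiniteRankNet B C)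
    (F : Finset (compactOperators B H)) {ε : ℝ} (hε : 0 < ε) :
    ∃ ψ : compactOperators B H →ₗ[ℂ] compactOperators B H,
      FiniteDimensional ℂ (LinearMap.range ψ) ∧ cbNorm ψ ≤ C ∧ ∀ T ∈ F, ‖ψ T - T‖ < ε := by
  obtain ⟨ι, _, _, _, φ, hfin, hcb, hlim⟩ := h.exists_net
  obtain ⟨Y, x, hx, hxF⟩ := exists_frameOperator_mul_mul_approx F hε
  have hev : ∀ᶠ i in atTop, ∀ T ∈ F, ‖compressed x (φ i) T - T‖ < ε :=
    (eventually_all_finset F).2 fun T hT => eventually_norm_compressed_sub_lt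
      (fun b => tendsto_iff_norm_sub_tendsto_zero.2 (hlim b)) (hxF T hT)
  obtain ⟨i, hi⟩ := hev.exists
  have := hfin i
  exact ⟨compressed x (φ i), finiteDimensional_range_compressed x (φ i),
    (cbNorm_compressed_le hx (φ i)).trans (hcb i), hi⟩

end RightHilbert

set_option synthInstance.maxHeartbeats 80000 in
lemma HasFiniteRankNet.compactOperators {B : Type u} [NonUnitalCStarAlgebra B] [PartialOrder B]
    [StarOrderedRing B] {H : Type v} [NormedAddCommGroup H] [NormedSpace ℂ H] [CompleteSpace H]
    [SMul Bᵐᵒᵖ H] [CStarModule Bᵐᵒᵖ H] {C : ℝ≥0} (h : HasFiniteRankNet B C) :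
    HasFiniteRankNet (RightHilbert.compactOperators B H) C :=
  let _ : PartialOrder (RightHilbert.compactOperators B H) := CStarAlgebra.spectralOrder _
  have _ : StarOrderedRing (RightHilbert.compactOperators B H) := CStarAlgebra.spectralOrderedRing _
  .of_forall_finset fun F _ hε => h.exists_approx_compactOperators F hε

/-- If `H` is a full right Hilbert `B`-module over a C⋆-algebra `B`, then `Λ(K(H)) ≤ Λ(B)`. -/
theorem proposition2p5 {B : Type u} [NonUnitalCStarAlgebra B] [PartialOrder B] [StarOrderedRing B]
    {H : Type v} [NormedAddCommGroup H] [NormedSpace ℂ H] [CompleteSpace H]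
    [SMul Bᵐᵒᵖ H] [CStarModule Bᵐᵒᵖ H] (hfull : RightHilbert.IsFull B H) :
    haagerupInvariant (RightHilbert.compactOperators B H) ≤ haagerupInvariant B :=
  le_iInf₂ fun C hC => iInf₂_le C hC.compactOperators

end
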